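/- Let $R$ be a commutative noetherian henselian local ring with residue field $k$, and let $\operatorname{mod} R$ be the category of finitely generated $R$-modules. A finitely generated $R$-module $M$ is *totally reflexive* if the natural map $M\to M^{**}$ is an isomorphism and $\operatorname{Ext}_R^i(M,R)=0=\operatorname{Ext}_R^i(M^*,R)$ for all $i>0$, where $(-)^*=\operatorname{Hom}_R(-,R)$. For a full subcategory $\mathcal X$ of $\operatorname{mod} R$, a *right $\mathcal X$-approximation* of an $R$-module $M$ is a homomorphism $\phi:X\to M$ with $X\in\mathcal X$ such that $\operatorname{Hom}_R(X',\phi):\operatorname{Hom}_R(X',X)\to\operatorname{Hom}_R(X',M)$ is surjective for every $X'\in\mathcal X$; and $\mathcal X$ is *contravariantly finite* if every finitely generated $R$-module has a right $\mathcal X$-approximation. The ring $R$ is *Gorenstein* if it has finite injective dimension as a module over itself. (a) Let $\mathcal X$ be one of the following full subcategories of $\operatorname{mod} R$: 1. the subcategory $\mathcal G(R)$ of totally reflexive modules; 2. $\{\,M \mid \operatorname{Ext}_R^i(M,R)=0 \text{ for all } i>n\,\}$, where $n\ge 0$ is an integer; 3. $\{\,M \mid \operatorname{Ext}_R^i(M,R)=0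 \text{ for all } i\gg 0\,\}$ (the bound may depend on $M$). If $\mathcal X$ contains a module of infinite projective dimension and $k$ has a right $\mathcal X$-approximation, then $R$ is Gorenstein. (b) If there is a nonfree totally reflexive $R$-module and $k$ has a right $\mathcal G(R)$-approximation, then $R$ is Gorenstein. (c) (Christensen–Piepmeyer–Striuli–Takahashi) If there is a nonfree totally reflexive $R$-module and $\mathcal G(R)$ is contravariantly finite, then $R$ is Gorenstein. -/

import Mathlib

open CategoryTheory CategoryTheory.Abelian

universe u

namespace RightApprox

section

variable (R : Type u) [CommRing R]

/-- The `i`-th Ext module `Ext_R^i(M, R)` is zero. -/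
def ExtToRingVanishes (M : ModuleCat.{u} R) (i : ℕ) : Prop :=
  Subsingleton (Ext M (ModuleCat.of R R) i)

/-- The subcategory `𝒢(R)` of totally reflexive modules: finitely generated modules `M` such that
the biduality map `M → M**` is an isomorphism and `Ext^i(M, R) = 0 = Ext^i(M*, R)` for all
`i > 0`. -/
def totallyReflexive : ObjectProperty (ModuleCat.{u} R) := fun M =>
  Module.Finite R M ∧ Function.Bijective (Module.Dual.eval R M) ∧
    ∀ i : ℕ, 0 < i →
      ExtToRingVanishes R M i ∧ ExtToRingVanishes R (ModuleCat.of R (Module.Dual R M)) i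

/-- The subcategory of finitely generated modules `M` with `Ext^i(M, R) = 0` for all `i > n`. -/
def extVanishingAbove (n : ℕ) : ObjectProperty (ModuleCat.{u} R) := fun M =>
  Module.Finite R M ∧ ∀ i : ℕ, n < i → ExtToRingVanishes R M i

/-- The subcategory of finitely generated modules `M` with `Ext^i(M, R) = 0` for `i ≫ 0`
(the bound may depend on `M`). -/
def extVanishingEventually : ObjectProperty (ModuleCat.{u} R) := fun M =>
  Module.Finite R M ∧ ∃ n : ℕ, ∀ i : ℕ, n < i → ExtToRingVanishes R M i

variable {R}

/-- A morphism `φ : X ⟶ M` with `X` in `𝒳` is a right `𝒳`-approximation of `M` if every morphism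
`X' ⟶ M` with `X'` in `𝒳` factors through `φ`, i.e. `Hom(X', X) → Hom(X', M)` is surjective. -/
def IsRightApproximation (𝒳 : ObjectProperty (ModuleCat.{u} R)) {X M : ModuleCat.{u} R}
    (φ : X ⟶ M) : Prop :=
  𝒳 X ∧ ∀ X' : ModuleCat.{u} R, 𝒳 X' → Function.Surjective (fun f : X' ⟶ X => f ≫ φ)

/-- The module `M` has a right `𝒳`-approximation. -/
def HasRightApproximation (𝒳 : ObjectProperty (ModuleCat.{u} R)) (M : ModuleCat.{u} R) : Prop :=
  ∃ (X : ModuleCat.{u} R) (φ : X ⟶ M), IsRightApproximation 𝒳 φ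

/-- `𝒳` is contravariantly finite in the category of finitely generated modules. -/
def IsContravariantlyFinite (𝒳 : ObjectProperty (ModuleCat.{u} R)) : Prop :=
  ∀ M : ModuleCat.{u} R, Module.Finite R M → HasRightApproximation 𝒳 M

variable (R)

/-- A noetherian local ring is Gorenstein if it has finite injective dimension as a module over
itself. -/
def IsGorenstein [IsLocalRing R] [IsNoetherianRing R] : Prop :=
  injectiveDimension (ModuleCat.of R R) ≠ ⊤

end

end RightApprox

/-!
Since `R` is henselian, there is a right minimal right `𝒳`-approximation `X → k`; let `Y` be its
kernel. By Wakamatsu's lemma `Ext¹(G, Y) = 0` for all `G` in `𝒳`. Let `0 → ΩG → F → G → 0` be a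
minimal free cover of such a `G`. As `Hom(G, k) ≃ Hom(F, k)` and `Ext^i(Hom(F, X), R) = 0` for
`i ≫ 0`, the isomorphisms `Ext^i(Hom(F, Y), R) ≃ Ext^{i+1}(Hom(F, k), R)` factor through the
connecting maps of `0 → Hom(G, Y) → Hom(G, X) → Hom(G, k) → 0`, which are therefore split
surjective. Together with the exactness of
`0 → Hom(G, X) → Hom(F, X) → Hom(ΩG, Y) → 0` this gives
`Ext^i(Hom(G, Y), R) ≃ Ext^{i+1}(Hom(ΩG, Y), R) × Ext^{i+1}(Hom(G, k), R)` for `i ≫ 0`.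
Replacing `G` by its iterated syzygies, the minimal number of generators of
`Ext^{i+n}(Hom(ΩⁿG, Y), R)` decreases with `n`, hence stabilizes, so
`Ext^{i+n+1}(Hom(ΩⁿG, k), R) = 0` for `n ≫ 0`. If `G` has infinite projective dimension, then
`ΩⁿG ≠ 0`, so `k` is a direct summand of `Hom(ΩⁿG, k)`, and `Ext^j(k, R) = 0` for `j ≫ 0`,
which by noetherian induction on primes bounds the injective dimension of `R`.
-/

namespace RightApprox

section Henselian

open Polynomial IsLocalRing

lemma exists_hasMap_lift {R : Type*} [CommRing R] [HenselianLocalRing R] (P : StandardEtalePair R)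
    {x : ResidueField R} (hx : P.HasMap x) : ∃ a : R, P.HasMap a ∧ residue R a = x := by
  have lift_simple_root := ((HenselianLocalRing.TFAE R).out 0 1).mp ‹_›
  obtain ⟨a, ha, rfl⟩ := lift_simple_root P.f P.monic_f x hx.1 hx.isUnit_derivative_f.ne_zero
  refine ⟨a, ⟨by simpa [coe_aeval_eq_eval] using ha, ?_⟩, rfl⟩
  rw [← isUnit_map_iff (residue R)]
  simpa [aeval_def, eval₂_at_apply, ← ResidueField.algebraMap_eq] using hx.2

lemma exists_algHom_lift_of_etale {R S : Type*} [CommRing R] [HenselianLocalRing R] [CommRing S]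
    [Algebra R S] [Algebra.Etale R S] (φ : S →ₐ[R] ResidueField R) :
    ∃ ψ : S →ₐ[R] R, ∀ s, residue R (ψ s) = φ s := by
  let Q : Ideal S := RingHom.ker φ
  have : Q.IsPrime := RingHom.ker_isPrime _
  have : Algebra.IsEtaleAt R Q :=
    have : Algebra.FormallyEtale S (Localization.AtPrime Q) := .of_isLocalization Q.primeCompl
    Algebra.FormallyEtale.comp R S (Localization.AtPrime Q)
  obtain ⟨f, hfQ, hf⟩ := Algebra.IsEtaleAt.exists_isStandardEtale (R := R) Q
  have hφf : IsUnit (φ f) := isUnit_iff_ne_zero.mpr hfQ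
  let φ' : Localization.Away f →ₐ[R] ResidueField R :=
    IsLocalization.Away.liftAlgHom f (f := φ) hφf
  obtain ⟨P⟩ := hf.nonempty_standardEtalePresentation
  obtain ⟨a, ha, hax⟩ := exists_hasMap_lift _ (P.hasMap.map φ')
  let ψ' : Localization.Away f →ₐ[R] R := (P.lift a ha).comp P.equivRing.toAlgHom
  have hψ' : (IsScalarTower.toAlgHom R R (ResidueField R)).comp ψ' = φ' :=
    P.hom_ext (by simpa [ψ'] using hax)
  refine ⟨ψ'.comp (IsScalarTower.toAlgHom R S (Localization.Away f)), fun s ↦ ?_⟩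
  simpa [φ'] using DFunLike.congr_fun hψ' (algebraMap S (Localization.Away f) s)

lemma exists_monic_factorization_lift {R : Type*} [CommRing R] [HenselianLocalRing R]
    {p : R[X]} (hp : p.Monic) {f g : (ResidueField R)[X]} (hf : f.Monic) (hg : g.Monic)
    (hfg : f * g = p.map (residue R)) (hc : IsCoprime f g) :
    ∃ f' g' : R[X], f' * g' = p ∧ IsCoprime f' g' ∧ f'.map (residue R) = f ∧
      g'.map (residue R) = g := by
  have hn : p.natDegree = f.natDegree + g.natDegree := by
    rw [← hf.natDegree_mul hg, hfg, hp.natDegree_map]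
  let p' := MonicDegreeEq.mk p hp rfl
  let f₀ := MonicDegreeEq.mk f hf rfl
  let g₀ := MonicDegreeEq.mk g hg rfl
  -- Coprime factorizations of `p` over `S` are the `R`-algebra maps to `S` from an étale algebra.
  let e := fun (S : Type _) [CommRing S] [Algebra R S] ↦
    UniversalCoprimeFactorizationRing.homEquiv S f.natDegree g.natDegree hn p'
  let φ := (e (ResidueField R)).symm ⟨(f₀, g₀), hfg, hc⟩
  obtain ⟨ψ, hψ⟩ := exists_algHom_lift_of_etale φ
  have hcomp : (IsScalarTower.toAlgHom R R (ResidueField R)).comp ψ = φ := AlgHom.ext hψ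
  let q := e R ψ
  have h₁ := UniversalCoprimeFactorizationRing.homEquiv_comp_fst R f.natDegree g.natDegree hn p' ψ
    (IsScalarTower.toAlgHom R R (ResidueField R))
  have h₂ := UniversalCoprimeFactorizationRing.homEquiv_comp_snd R f.natDegree g.natDegree hn p' ψ
    (IsScalarTower.toAlgHom R R (ResidueField R))
  have h₀ : e (ResidueField R) φ = ⟨(f₀, g₀), hfg, hc⟩ := Equiv.apply_symm_apply _ _
  rw [hcomp] at h₁ h₂
  refine ⟨q.1.1.1, q.1.2.1, by simpa using! q.2.1, q.2.2, ?_, ?_⟩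
  · exact (congrArg Subtype.val h₁).symm.trans (congrArg (fun z ↦ z.1.1.1) h₀)
  · exact (congrArg Subtype.val h₂).symm.trans (congrArg (fun z ↦ z.1.2.1) h₀)

lemma exists_factorization_isUnit_eval {R : Type*} [CommRing R] [HenselianLocalRing R]
    {p : R[X]} (hp : p.Monic) :
    ∃ f g : R[X], f * g = p ∧ IsCoprime f g ∧ IsUnit (f.eval 1) ∧ IsUnit (g.eval 0) := by
  obtain ⟨g₀, hg₀, hXg₀⟩ := exists_eq_pow_rootMultiplicity_mul_and_not_dvd
    (p.map (residue R)) (hp.map _).ne_zero 0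
  rw [C_0, sub_zero] at hg₀ hXg₀
  set n := rootMultiplicity 0 (p.map (residue R))
  have hg₀_monic : g₀.Monic := (monic_X_pow n).of_mul_monic_left (hg₀ ▸ hp.map _)
  have hcop : IsCoprime (X ^ n) g₀ :=
    ((irreducible_X (R := ResidueField R)).coprime_iff_not_dvd.mpr hXg₀).pow_left
  obtain ⟨f, g, hfg, hc, hf, hg⟩ :=
    exists_monic_factorization_lift hp (monic_X_pow n) hg₀_monic hg₀.symm hcop
  refine ⟨f, g, hfg, hc, ?_, ?_⟩ <;> rw [← isUnit_map_iff (residue R), isUnit_iff_ne_zero]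
  · rw [← eval_one_map, hf]
    simp
  · rwa [← eval_zero_map, hg, ← coeff_zero_eq_eval_zero, Ne, ← X_dvd_iff]

end Henselian

section Fitting

open Polynomial LinearMap

variable {R : Type*} [CommRing R]

lemma isCoprime_X_sub_C_of_isUnit_eval {p : R[X]} {a : R} (h : IsUnit (p.eval a)) :
    IsCoprime (X - C a) p := by
  obtain ⟨q, hq⟩ := X_sub_C_dvd_sub_C_eval (p := p) (a := a)
  have : p = C (p.eval a) + (X - C a) * q := by rw [← hq]; ring
  rw [this, IsCoprime.add_mul_left_right_iff]
  obtain ⟨c, hc⟩ := h.map C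
  exact ⟨0, ↑c⁻¹, by simp [← hc]⟩

variable {M : Type*} [AddCommGroup M] [Module R M]

lemma bijOn_ker_aeval_of_isCoprime (u : Module.End R M) {p q : R[X]} (h : IsCoprime p q) :
    Set.BijOn (aeval u p) (ker (aeval u q)) (ker (aeval u q)) := by
  have commute (r s : R[X]) (x : M) : aeval u r (aeval u s x) = aeval u s (aeval u r x) := by
    simp only [← Module.End.mul_apply, ← map_mul, mul_comm]
  have mapsTo (r : R[X]) : Set.MapsTo (aeval u r) (ker (aeval u q)) (ker (aeval u q)) :=
    fun x hx ↦ by rw [SetLike.mem_coe, mem_ker, commute, hx, map_zero]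
  obtain ⟨a, b, hab⟩ := h
  have inverse (x : M) (hx : aeval u q x = 0) : aeval u a (aeval u p x) = x := by
    simpa [hx] using congr(aeval u $hab x)
  refine Set.InvOn.bijOn ⟨inverse, fun x hx ↦ ?_⟩ (mapsTo p) (mapsTo a)
  rw [commute, inverse x hx]

lemma exists_isCompl_bijOn [HenselianLocalRing R] [Module.Finite R M] (u : Module.End R M) :
    ∃ K L : Submodule R M, IsCompl K L ∧ Set.BijOn u K K ∧
      Set.BijOn (1 - u : Module.End R M) L L := by
  obtain ⟨p, hp, hpu⟩ := exists_monic_and_aeval_eq_zero R u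
  obtain ⟨f, g, rfl, hfg, hf, hg⟩ := exists_factorization_isUnit_eval hp
  refine ⟨ker (aeval u g), ker (aeval u f), ⟨?_, ?_⟩, ?_, ?_⟩
  · exact disjoint_ker_aeval_of_isCoprime u hfg.symm
  · rw [codisjoint_iff, sup_comm, sup_ker_aeval_eq_ker_aeval_mul_of_coprime u hfg, hpu, ker_zero]
  · simpa using bijOn_ker_aeval_of_isCoprime u (isCoprime_X_sub_C_of_isUnit_eval hg)
  · simpa using bijOn_ker_aeval_of_isCoprime u (isCoprime_X_sub_C_of_isUnit_eval hf).neg_left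

end Fitting

section MinimalGenerators

open IsLocalRing TensorProduct

variable {R : Type*} [CommRing R] {M N : Type*} [AddCommGroup M] [Module R M]
  [AddCommGroup N] [Module R N]

lemma spanFinrank_top_congr (e : M ≃ₗ[R] N) :
    (⊤ : Submodule R M).spanFinrank = (⊤ : Submodule R N).spanFinrank := by
  rw [← Submodule.spanFinrank_map_eq_of_injective e.toLinearMap e.injective, Submodule.map_top,
    LinearEquiv.range]

lemma spanFinrank_top_eq_zero_iff [Module.Finite R M] :
    (⊤ : Submodule R M).spanFinrank = 0 ↔ Subsingleton M := by
  rw [Submodule.spanFinrank_eq_zero_iff_eq_bot Module.Finite.fg_top, eq_comm,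
    subsingleton_iff_bot_eq_top, Submodule.subsingleton_iff]

variable [IsLocalRing R] [Module.Finite R M]

lemma spanFinrank_top_eq_finrank_residueField_tensor :
    (⊤ : Submodule R M).spanFinrank =
      Module.finrank (ResidueField R) (ResidueField R ⊗[R] M) := by
  rw [← TensorProduct.spanFinrank_top_eq_of_residueField ⊤ Module.Finite.fg_top,
    ← Module.finrank_eq_spanFinrank_of_free]
  exact (Submodule.topEquiv.baseChange R (ResidueField R) _ _).finrank_eq

lemma spanFinrank_top_prod [Module.Finite R N] :
    (⊤ : Submodule R (M × N)).spanFinrank =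
      (⊤ : Submodule R M).spanFinrank + (⊤ : Submodule R N).spanFinrank := by
  simp only [spanFinrank_top_eq_finrank_residueField_tensor]
  exact (TensorProduct.prodRight R (ResidueField R) (ResidueField R) M N).finrank_eq.trans
    (Module.finrank_prod ..)

variable (R M) in
lemma exists_minimal_free_cover :
    ∃ (n : ℕ) (π : (Fin n → R) →ₗ[R] M), Function.Surjective π ∧
      LinearMap.ker π ≤ maximalIdeal R • ⊤ := by
  let b := Module.finBasis (ResidueField R) (ResidueField R ⊗[R] M)
  obtain ⟨v, hv⟩ := (TensorProduct.mk_surjective R M _ residue_surjective).comp_left b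
  have hv (i) : (1 : ResidueField R) ⊗ₜ[R] v i = b i := congr_fun hv i
  refine ⟨_, Fintype.linearCombination R v, ?_, fun x hx ↦ ?_⟩
  · rw [← LinearMap.range_eq_top, Fintype.range_linearCombination]
    exact span_eq_top_of_tmul_eq_basis v b hv
  · have hx' : ∑ i, residue R (x i) • b i = 0 :=
      calc ∑ i, residue R (x i) • b i
          = 1 ⊗ₜ[R] Fintype.linearCombination R v x := by
            simp only [Fintype.linearCombination_apply, tmul_sum, tmul_smul, hv]
            exact Finset.sum_congr rfl fun i _ ↦ algebraMap_smul (ResidueField R) (x i) (b i)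
        _ = 0 := by rw [hx, tmul_zero]
    have mem_maximalIdeal (i) : x i ∈ maximalIdeal R := (residue_eq_zero_iff _).mp <|
      Fintype.linearIndependent_iff.mp b.linearIndependent _ hx' i
    rw [pi_eq_sum_univ x]
    exact sum_mem fun i _ ↦ Submodule.smul_mem_smul (mem_maximalIdeal i) Submodule.mem_top

end MinimalGenerators

section Ext

universe w v'

variable {C : Type u} [Category.{v'} C] [Abelian C] [HasExt.{w} C]

lemma subsingleton_ext_of_retract {A X : C} (r : Retract A X) (N : C) (n : ℕ)
    [Subsingleton (Ext X N n)] : Subsingleton (Ext A N n) := by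
  refine subsingleton_of_forall_eq 0 fun x ↦ ?_
  rw [← Ext.mk₀_id_comp x, ← r.retract, ← Ext.mk₀_comp_mk₀_assoc,
    Subsingleton.elim ((Ext.mk₀ r.r).comp x _) 0, Ext.comp_zero]

lemma subsingleton_ext_of_retract_target {A X : C} (r : Retract A X) (M : C) (n : ℕ)
    [Subsingleton (Ext M X n)] : Subsingleton (Ext M A n) := by
  refine subsingleton_of_forall_eq 0 fun x ↦ ?_
  rw [← Ext.comp_mk₀_id x, ← r.retract, ← Ext.mk₀_comp_mk₀,
    ← Ext.comp_assoc_of_third_deg_zero, Subsingleton.elim (x.comp (Ext.mk₀ r.i) _) 0,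
    Ext.zero_comp]

variable {S : ShortComplex C} (hS : S.ShortExact) (N : C)

section LongExactSequence

include hS

lemma subsingleton_ext_X₁ {n : ℕ} [Subsingleton (Ext S.X₂ N n)]
    [Subsingleton (Ext S.X₃ N (n + 1))] : Subsingleton (Ext S.X₁ N n) := by
  refine subsingleton_of_forall_eq 0 fun x ↦ ?_
  obtain ⟨y, rfl⟩ := Ext.contravariant_sequence_exact₁ hS N x (add_comm 1 n)
    (Subsingleton.elim _ _)
  rw [Subsingleton.elim y 0, Ext.comp_zero]

lemma subsingleton_ext_X₂ {n : ℕ} [Subsingleton (Ext S.X₁ N n)]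
    [Subsingleton (Ext S.X₃ N n)] : Subsingleton (Ext S.X₂ N n) := by
  refine subsingleton_of_forall_eq 0 fun x ↦ ?_
  obtain ⟨y, rfl⟩ := Ext.contravariant_sequence_exact₂ hS N x (Subsingleton.elim _ _)
  rw [Subsingleton.elim y 0, Ext.comp_zero]

lemma subsingleton_ext_X₃ {n : ℕ} [Subsingleton (Ext S.X₁ N n)]
    [Subsingleton (Ext S.X₂ N (n + 1))] : Subsingleton (Ext S.X₃ N (n + 1)) := by
  refine subsingleton_of_forall_eq 0 fun x ↦ ?_
  obtain ⟨y, rfl⟩ := Ext.contravariant_sequence_exact₃ hS N x (Subsingleton.elim _ _)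
    (add_comm 1 n)
  rw [Subsingleton.elim y 0, Ext.comp_zero]

lemma exists_extension_of_subsingleton_ext {N : C} [Subsingleton (Ext S.X₃ N 1)]
    (f : S.X₁ ⟶ N) : ∃ g : S.X₂ ⟶ N, S.f ≫ g = f := by
  obtain ⟨y, hy⟩ := Ext.contravariant_sequence_exact₁ hS N (Ext.mk₀ f) (add_zero 1)
    (Subsingleton.elim _ _)
  obtain ⟨g, rfl⟩ := (Ext.mk₀_bijective _ _).2 y
  exact ⟨g, (Ext.mk₀_bijective _ _).1 (by simpa using hy)⟩

lemma subsingleton_ext_one_X₃ {N : C} [Subsingleton (Ext S.X₂ N 1)]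
    (h : ∀ f : S.X₁ ⟶ N, ∃ g : S.X₂ ⟶ N, S.f ≫ g = f) : Subsingleton (Ext S.X₃ N 1) := by
  refine subsingleton_of_forall_eq 0 fun x ↦ ?_
  obtain ⟨y, rfl⟩ := Ext.contravariant_sequence_exact₃ hS N x (Subsingleton.elim _ _)
    (add_zero 1)
  obtain ⟨f, rfl⟩ := (Ext.mk₀_bijective _ _).2 y
  obtain ⟨g, rfl⟩ := h f
  rw [← Ext.mk₀_comp_mk₀, hS.extClass_comp_assoc]

lemma subsingleton_ext_target_X₃ (M : C) {n : ℕ} [Subsingleton (Ext M S.X₂ n)]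
    [Subsingleton (Ext M S.X₁ (n + 1))] : Subsingleton (Ext M S.X₃ n) := by
  refine subsingleton_of_forall_eq 0 fun x ↦ ?_
  obtain ⟨y, rfl⟩ := Ext.covariant_sequence_exact₃ M hS x rfl (Subsingleton.elim _ _)
  rw [Subsingleton.elim y 0, Ext.zero_comp]

end LongExactSequence

variable (R : Type*) [CommRing R] [Linear R C]

/-- The connecting homomorphism of the long exact sequence for `Ext(-, N)`. -/
noncomputable def extConnecting (n : ℕ) : Ext S.X₁ N n →ₗ[R] Ext S.X₃ N (n + 1) :=
  hS.extClass.precompOfLinear R N (add_comm 1 n)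

lemma extConnecting_bijective {n : ℕ} [Subsingleton (Ext S.X₂ N n)]
    [Subsingleton (Ext S.X₂ N (n + 1))] : Function.Bijective (extConnecting hS N R n) := by
  refine ⟨(injective_iff_map_eq_zero _).mpr fun x hx ↦ ?_, fun x ↦
    Ext.contravariant_sequence_exact₃ hS N x (Subsingleton.elim _ _) (add_comm 1 n)⟩
  obtain ⟨y, rfl⟩ := Ext.contravariant_sequence_exact₁ hS N x (add_comm 1 n) hx
  rw [Subsingleton.elim y 0, Ext.comp_zero]

lemma extConnecting_naturality {S' : ShortComplex C} (hS' : S'.ShortExact) (φ : S ⟶ S') {n : ℕ}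
    (x : Ext S'.X₁ N n) :
    extConnecting hS N R n ((Ext.mk₀ φ.τ₁).comp x (zero_add n)) =
      (Ext.mk₀ φ.τ₃).comp (extConnecting hS' N R n x) (zero_add _) := by
  change hS.extClass.comp ((Ext.mk₀ φ.τ₁).comp x (zero_add n)) (add_comm 1 n) =
    (Ext.mk₀ φ.τ₃).comp (hS'.extClass.comp x (add_comm 1 n)) (zero_add _)
  rw [← Ext.comp_assoc_of_second_deg_zero, ShortComplex.ShortExact.extClass_naturality hS hS' φ,
    Ext.comp_assoc _ _ _ (zero_add 1) (add_comm 1 n) (by lia)]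

lemma exists_section_extConnecting {S' : ShortComplex C} (hS' : S'.ShortExact) (φ : S ⟶ S')
    [IsIso φ.τ₃] {n : ℕ} [Subsingleton (Ext S'.X₂ N n)] [Subsingleton (Ext S'.X₂ N (n + 1))] :
    ∃ σ : Ext S.X₃ N (n + 1) →ₗ[R] Ext S.X₁ N n, extConnecting hS N R n ∘ₗ σ = .id := by
  let e := LinearEquiv.ofBijective _ (extConnecting_bijective hS' N R (n := n))
  let τ : Ext S.X₃ N (n + 1) →ₗ[R] Ext S'.X₃ N (n + 1) :=
    (Ext.mk₀ (inv φ.τ₃)).precompOfLinear R N (zero_add _)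
  refine ⟨(Ext.mk₀ φ.τ₁).precompOfLinear R N (zero_add n) ∘ₗ e.symm ∘ₗ τ,
    LinearMap.ext fun x ↦ ?_⟩
  calc extConnecting hS N R n ((Ext.mk₀ φ.τ₁).comp (e.symm (τ x)) (zero_add n))
      = (Ext.mk₀ φ.τ₃).comp (e (e.symm (τ x))) (zero_add _) :=
        extConnecting_naturality hS N R hS' φ _
    _ = (Ext.mk₀ φ.τ₃).comp ((Ext.mk₀ (inv φ.τ₃)).comp x (zero_add _)) (zero_add _) := by
        rw [e.apply_symm_apply]; rfl
    _ = x := by rw [Ext.mk₀_comp_mk₀_assoc, IsIso.hom_inv_id, Ext.mk₀_id_comp]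

lemma nonempty_ext_linearEquiv_prod {n : ℕ}
    (h : Function.Surjective (extConnecting hS N R n))
    (hsec : ∃ σ : Ext S.X₃ N (n + 2) →ₗ[R] Ext S.X₁ N (n + 1),
      extConnecting hS N R (n + 1) ∘ₗ σ = .id) :
    Nonempty (Ext S.X₁ N (n + 1) ≃ₗ[R] Ext S.X₂ N (n + 1) × Ext S.X₃ N (n + 2)) := by
  let α : Ext S.X₂ N (n + 1) →ₗ[R] Ext S.X₁ N (n + 1) :=
    (Ext.mk₀ S.f).precompOfLinear R N (zero_add _)
  have hα : Function.Injective α := by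
    refine (injective_iff_map_eq_zero _).mpr fun x hx ↦ ?_
    obtain ⟨y, rfl⟩ := Ext.contravariant_sequence_exact₂ hS N x hx
    obtain ⟨z, rfl⟩ := h y
    exact hS.comp_extClass_assoc z (add_comm 1 n)
  have hexact : Function.Exact α (extConnecting hS N R (n + 1)) := fun x ↦
    ⟨fun hx ↦ Ext.contravariant_sequence_exact₁ hS N x (add_comm 1 (n + 1)) hx, fun ⟨y, hy⟩ ↦
      hy ▸ hS.extClass_comp_assoc y (h := add_comm 1 (n + 1))⟩
  exact ⟨(hexact.splitSurjectiveEquiv hα ⟨hsec.choose, hsec.choose_spec⟩).1⟩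

end Ext

section InjectiveDimension

open IsLocalRing Pointwise

variable {R : Type u} [CommRing R]

lemma injective_of_subsingleton_ext_one_quotient (M : ModuleCat.{u} R)
    (h : ∀ I : Ideal R, Subsingleton (Ext (ModuleCat.of R (R ⧸ I)) M 1)) : Injective M := by
  rw [← Module.injective_iff_injective_object R M, ← Module.Baer.iff_injective]
  intro I g
  let S := ModuleCat.shortComplexOfCompEqZero I.subtype I.mkQ
    (LinearMap.exact_subtype_mkQ I).linearMap_comp_eq_zero
  have hS : S.ShortExact := ModuleCat.shortComplex_shortExact S (LinearMap.exact_subtype_mkQ I)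
    I.injective_subtype I.mkQ_surjective
  have : Subsingleton (Ext S.X₃ M 1) := h I
  obtain ⟨f, hf⟩ := exists_extension_of_subsingleton_ext hS (N := M) (ModuleCat.ofHom g)
  exact ⟨f.hom, fun x hx ↦ congr($(hf).hom ⟨x, hx⟩)⟩

lemma hasInjectiveDimensionLT_of_subsingleton_ext_quotient (n : ℕ) (M : ModuleCat.{u} R)
    (h : ∀ I : Ideal R, Subsingleton (Ext (ModuleCat.of R (R ⧸ I)) M (n + 1))) :
    HasInjectiveDimensionLT M (n + 1) := by
  induction n generalizing M with
  | zero =>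
    exact injective_iff_hasInjectiveDimensionLT_one.mp <|
      injective_of_subsingleton_ext_one_quotient M h
  | succ n ih =>
    obtain ⟨J, _, f, _⟩ := EnoughInjectives.presentation M
    let S := ShortComplex.mk f (Limits.cokernel.π f) (Limits.cokernel.condition f)
    have hS : S.ShortExact := { exact := ShortComplex.exact_cokernel f }
    refine (hS.hasInjectiveDimensionLT_X₃_iff n ‹_›).mp (ih S.X₃ fun I ↦ ?_)
    have : Subsingleton (Ext (ModuleCat.of R (R ⧸ I)) S.X₂ (n + 1)) :=
      subsingleton_of_forall_eq 0 Ext.eq_zero_of_injective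
    have : Subsingleton (Ext (ModuleCat.of R (R ⧸ I)) S.X₁ (n + 1 + 1)) := h I
    exact subsingleton_ext_target_X₃ hS _

variable [IsNoetherianRing R]

lemma subsingleton_ext_of_forall_prime (N : ModuleCat.{u} R) (j : ℕ) (I : Ideal R)
    (h : ∀ q : Ideal R, q.IsPrime → I ≤ q → Subsingleton (Ext (ModuleCat.of R (R ⧸ q)) N j))
    (M : Type u) [AddCommGroup M] [Module R M] [hM : Module.Finite R M]
    (hIM : I ≤ Module.annihilator R M) : Subsingleton (Ext (ModuleCat.of R M) N j) := by
  induction hM using IsNoetherianRing.induction_on_isQuotientEquivQuotientPrime R with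
  | subsingleton L =>
    have := (ModuleCat.isZero_of_subsingleton (ModuleCat.of R L)).hasProjectiveDimensionLT_zero
    exact HasProjectiveDimensionLT.subsingleton (ModuleCat.of R L) 0 j (Nat.zero_le j) N
  | quotient L p e =>
    have := h p.1 p.2 (by rwa [e.annihilator_eq, Ideal.annihilator_quotient] at hIM)
    exact subsingleton_ext_of_retract e.toModuleIso.retract N j
  | exact L₁ L₂ L₃ f g hf hg hfg h₁ h₃ =>
    let S := ModuleCat.shortComplexOfCompEqZero f g hfg.linearMap_comp_eq_zero
    have hS : S.ShortExact := ModuleCat.shortComplex_shortExact S hfg hf hg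
    have : Subsingleton (Ext S.X₁ N j) := h₁ (hIM.trans (f.annihilator_le_of_injective hf))
    have : Subsingleton (Ext S.X₃ N j) := h₃ (hIM.trans (g.annihilator_le_of_surjective hg))
    exact subsingleton_ext_X₂ hS N

variable [IsLocalRing R]

lemma subsingleton_ext_of_isSMulRegular {M N : ModuleCat.{u} R} [Module.Finite R M]
    [Module.Finite R N] {x : R} (hx : x ∈ maximalIdeal R) (hxM : IsSMulRegular M x) (j : ℕ)
    [Subsingleton (Ext (ModuleCat.of R (QuotSMulTop x M)) N (j + 1))] :
    Subsingleton (Ext M N j) := by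
  have hS := hxM.smulShortComplex_shortExact
  have mk₀_comp (z : Ext M N j) : (Ext.mk₀ (x • 𝟙 M)).comp z (zero_add j) = x • z := by
    rw [Ext.mk₀_smul, Ext.smul_comp, Ext.mk₀_id_comp]
  have smul_surjective (y : Ext M N j) : ∃ z : Ext M N j, x • z = y := by
    obtain ⟨z, hz⟩ := Ext.contravariant_sequence_exact₁ hS N y (add_comm 1 j)
      (Subsingleton.elim (α := Ext (ModuleCat.of R (QuotSMulTop x M)) N (j + 1)) _ _)
    exact ⟨z, (mk₀_comp z).symm.trans hz⟩
  have top_eq_bot : (⊤ : Submodule R (Ext M N j)) = ⊥ := by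
    refine Submodule.eq_bot_of_le_smul_of_le_jacobson_bot (maximalIdeal R) ⊤
      Module.Finite.fg_top (fun y _ ↦ ?_) (maximalIdeal_le_jacobson ⊥)
    obtain ⟨z, rfl⟩ := smul_surjective y
    exact Submodule.smul_mem_smul hx Submodule.mem_top
  exact (Submodule.subsingleton_iff R).mp (subsingleton_of_bot_eq_top top_eq_bot.symm)

lemma subsingleton_ext_of_residueField (N : ModuleCat.{u} R) [Module.Finite R N] (n : ℕ)
    (h : ∀ j ≥ n, Subsingleton (Ext (ModuleCat.of R (ResidueField R)) N j))
    (M : ModuleCat.{u} R) [Module.Finite R M] (j : ℕ) (hj : n ≤ j) :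
    Subsingleton (Ext M N j) := by
  have prime (p : Ideal R) (hp : p.IsPrime) (j : ℕ) (hj : n ≤ j) :
      Subsingleton (Ext (ModuleCat.of R (R ⧸ p)) N j) := by
    induction p using WellFoundedGT.induction generalizing j with | ind p ih =>
    by_cases hpm : p = maximalIdeal R
    · subst hpm
      exact h j hj
    obtain ⟨x, hx, hxp⟩ := SetLike.exists_of_lt ((le_maximalIdeal hp.ne_top).lt_of_ne hpm)
    have hreg : IsSMulRegular (R ⧸ p) x :=
      (isSMulRegular_quotient_iff_mem_of_smul_mem p x).mpr fun a ha ↦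
        (hp.mem_or_mem ha).resolve_left hxp
    have hann : p ⊔ Ideal.span {x} ≤ Module.annihilator R (QuotSMulTop x (R ⧸ p)) := by
      refine sup_le ?_ ((Ideal.span_singleton_le_iff_mem _).mpr
        (QuotSMulTop.mem_annihilator (R ⧸ p) x))
      exact Ideal.annihilator_quotient.ge.trans <| LinearMap.annihilator_le_of_surjective
        (x • (⊤ : Submodule R (R ⧸ p))).mkQ (Submodule.mkQ_surjective _)
    have : Subsingleton (Ext (ModuleCat.of R (QuotSMulTop x (R ⧸ p))) N (j + 1)) := by
      refine subsingleton_ext_of_forall_prime N (j + 1) _ (fun q hq hpq ↦ ?_) _ hann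
      obtain ⟨hpq, hxq⟩ := sup_le_iff.mp hpq
      refine ih q (hpq.lt_of_ne ?_) hq (j + 1) (by lia)
      rintro rfl
      exact hxp ((Ideal.span_singleton_le_iff_mem _).mp hxq)
    exact subsingleton_ext_of_isSMulRegular (M := ModuleCat.of R (R ⧸ p)) hx hreg j
  exact subsingleton_ext_of_forall_prime N j ⊥ (fun q hq _ ↦ prime q hq j hj) M bot_le

lemma injectiveDimension_ne_top_of_subsingleton_ext_residueField (N : ModuleCat.{u} R)
    [Module.Finite R N] (n : ℕ)
    (h : ∀ j ≥ n, Subsingleton (Ext (ModuleCat.of R (ResidueField R)) N j)) :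
    injectiveDimension N ≠ ⊤ :=
  (injectiveDimension_ne_top_iff _).mpr ⟨n, hasInjectiveDimensionLT_of_subsingleton_ext_quotient n
    N fun I ↦ subsingleton_ext_of_residueField N n h (ModuleCat.of R (R ⧸ I)) (n + 1) (by lia)⟩

end InjectiveDimension

section RightMinimal

/-- A morphism `φ` is right minimal if every endomorphism `u` of its source with `u ≫ φ = φ` is an
isomorphism. -/
def IsRightMinimal {C : Type*} [Category* C] {X L : C} (φ : X ⟶ L) : Prop :=
  ∀ u : X ⟶ X, u ≫ φ = φ → IsIso u

variable {R : Type u} [CommRing R] {𝒳 : ObjectProperty (ModuleCat.{u} R)}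

lemma IsRightApproximation.comp_retract [𝒳.IsStableUnderRetracts] {K X L : ModuleCat.{u} R}
    {φ : X ⟶ L} (hφ : IsRightApproximation 𝒳 φ) (r : Retract K X) (h : r.r ≫ r.i ≫ φ = φ) :
    IsRightApproximation 𝒳 (r.i ≫ φ) := by
  refine ⟨𝒳.prop_of_retract r hφ.1, fun X' hX' f ↦ ?_⟩
  obtain ⟨g, rfl⟩ := hφ.2 X' hX' f
  exact ⟨g ≫ r.r, by simp [h]⟩

lemma IsRightApproximation.restrict_of_isCompl [𝒳.IsStableUnderRetracts] {X L : ModuleCat.{u} R}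
    {φ : X ⟶ L} (hφ : IsRightApproximation 𝒳 φ) {K K' : Submodule R X} (h : IsCompl K K')
    (hK' : K' ≤ LinearMap.ker φ.hom) :
    IsRightApproximation 𝒳 (ModuleCat.ofHom K.subtype ≫ φ) := by
  let r : Retract (ModuleCat.of R K) X :=
    { i := ModuleCat.ofHom K.subtype
      r := ModuleCat.ofHom (K.projectionOnto K' h)
      retract := by ext x : 2; exact Submodule.projectionOnto_apply_left h x }
  refine hφ.comp_retract r ?_
  ext x
  have : x - K.projectionOnto K' h x ∈ K' := by
    rw [← Submodule.projectionOnto_apply_eq_zero_iff h, map_sub,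
      Submodule.projectionOnto_apply_left, sub_self]
  exact (sub_eq_zero.mp ((map_sub φ.hom _ _).symm.trans (hK' this))).symm

lemma exists_isRightMinimal_approximation [HenselianLocalRing R] [𝒳.IsStableUnderRetracts]
    (hfin : ∀ M, 𝒳 M → Module.Finite R M) {L : ModuleCat.{u} R}
    (hL : HasRightApproximation 𝒳 L) :
    ∃ (X : ModuleCat.{u} R) (φ : X ⟶ L), IsRightApproximation 𝒳 φ ∧ IsRightMinimal φ := by
  classical
  have exists_generators : ∃ n, ∃ (X : ModuleCat.{u} R) (φ : X ⟶ L),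
      IsRightApproximation 𝒳 φ ∧ (⊤ : Submodule R X).spanFinrank = n :=
    let ⟨X, φ, hφ⟩ := hL; ⟨_, X, φ, hφ, rfl⟩
  obtain ⟨X, φ, hφ, hX⟩ := Nat.find_spec exists_generators
  refine ⟨X, φ, hφ, fun u hu ↦ ?_⟩
  have := hfin X hφ.1
  obtain ⟨K, K', hKK', hK, hK'⟩ := exists_isCompl_bijOn u.hom
  have hφK' : K' ≤ LinearMap.ker φ.hom := fun x hx ↦ by
    obtain ⟨y, -, rfl⟩ := hK'.surjOn hx
    simpa [sub_eq_zero] using congr($(hu).hom y).symm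
  have hφK := hφ.restrict_of_isCompl hKK' hφK'
  have hle := Nat.find_min' exists_generators ⟨_, _, hφK, rfl⟩
  have : Module.Finite R K := hfin _ hφK.1
  have : Module.Finite R K' :=
    .of_surjective _ (Submodule.projectionOnto_surjective hKK'.symm)
  have : Subsingleton K' := by
    rw [← spanFinrank_top_eq_zero_iff (R := R)]
    rw [← hX, ← spanFinrank_top_congr (K.prodEquivOfIsCompl K' hKK'), spanFinrank_top_prod] at hle
    exact Nat.le_zero.mp ((add_le_iff_nonpos_right _).mp hle)
  have hKtop : K = ⊤ := by
    rw [← sup_bot_eq K, ← K'.subsingleton_iff_eq_bot.mp this, hKK'.sup_eq_top]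
  rw [ConcreteCategory.isIso_iff_bijective, ← Set.bijOn_univ, ← Submodule.top_coe (R := R), ← hKtop]
  exact hK

lemma shortExact_pushout {C : Type*} [Category* C] [Abelian C] {S : ShortComplex C}
    (hS : S.ShortExact) {X : C} (f : S.X₁ ⟶ X) :
    (ShortComplex.mk (Limits.pushout.inr S.f f)
      (Limits.pushout.desc S.g (0 : X ⟶ S.X₃) (by rw [S.zero, Limits.comp_zero]))
      (Limits.pushout.inr_desc ..)).ShortExact := by
  have := hS.mono_f
  have := hS.epi_g
  have epi_desc (w : S.f ≫ S.g = f ≫ 0) : Epi (Limits.pushout.desc S.g (0 : X ⟶ S.X₃) w) :=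
    epi_of_epi_fac (Limits.pushout.inl_desc ..)
  refine { exact := ShortComplex.exact_of_g_is_cokernel _ <|
    Limits.CokernelCofork.IsColimit.ofπ' _ _ fun k hk ↦
      ⟨hS.exact.desc (Limits.pushout.inl S.f f ≫ k) ?_, Limits.pushout.hom_ext ?_ ?_⟩ }
  · rw [Limits.pushout.condition_assoc, hk, Limits.comp_zero]
  · rw [Limits.pushout.inl_desc_assoc]; exact hS.exact.g_desc ..
  · rw [Limits.pushout.inr_desc_assoc, Limits.zero_comp, hk]

/-- Wakamatsu's lemma, which amounts to `Ext¹(X', ker φ) = 0` for all `X'` in `𝒳`. -/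
lemma IsRightApproximation.exists_extension [𝒳.IsClosedUnderExtensions] {X L : ModuleCat.{u} R}
    {φ : X ⟶ L} (hφ : IsRightApproximation 𝒳 φ) (hmin : IsRightMinimal φ)
    {S : ShortComplex (ModuleCat.{u} R)} (hS : S.ShortExact) (hX₃ : 𝒳 S.X₃) (f : S.X₁ ⟶ X)
    (hf : f ≫ φ = 0) : ∃ g : S.X₂ ⟶ X, g ≫ φ = 0 ∧ S.f ≫ g = f := by
  let inl := Limits.pushout.inl S.f f
  let inr := Limits.pushout.inr S.f f
  obtain ⟨s, hs : s ≫ φ = _⟩ := hφ.2 _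
    (𝒳.prop_X₂_of_shortExact (shortExact_pushout hS f) hφ.1 hX₃)
    (Limits.pushout.desc 0 φ (by rw [hf, Limits.comp_zero]))
  have hinl : inl ≫ s ≫ φ = 0 := by rw [hs]; exact Limits.pushout.inl_desc ..
  have hinr : inr ≫ s ≫ φ = φ := by rw [hs]; exact Limits.pushout.inr_desc ..
  have := hmin (inr ≫ s) ((Category.assoc ..).trans hinr)
  have hinv : inv (inr ≫ s) ≫ φ = φ := by rw [IsIso.inv_comp_eq, Category.assoc, hinr]
  refine ⟨inl ≫ s ≫ inv (inr ≫ s), by simp only [Category.assoc, hinv, hinl], ?_⟩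
  rw [Limits.pushout.condition_assoc, ← Category.assoc inr, IsIso.hom_inv_id, Category.comp_id]

end RightMinimal

section ExtPi

variable {R : Type u} [CommRing R] {ι : Type} [Finite ι] (X : ι → ModuleCat.{u} R)
  (N : ModuleCat.{u} R) (i : ℕ)

lemma subsingleton_ext_pi [∀ j, Subsingleton (Ext (X j) N i)] :
    Subsingleton (Ext (ModuleCat.of R (∀ j, X j)) N i) :=
  have := Fintype.ofFinite ι
  have := (Ext.biproductAddEquiv (Limits.biproduct.isBilimit X) N i).toEquiv.subsingleton
  subsingleton_ext_of_retract (ModuleCat.biproductIsoPi X).symm.retract N i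

lemma subsingleton_ext_target_pi [∀ j, Subsingleton (Ext N (X j) i)] :
    Subsingleton (Ext N (ModuleCat.of R (∀ j, X j)) i) :=
  have := Fintype.ofFinite ι
  have := (Ext.addEquivBiproduct N (Limits.biproduct.isBilimit X) i).toEquiv.subsingleton
  subsingleton_ext_of_retract_target (ModuleCat.biproductIsoPi X).symm.retract N i

end ExtPi

section ResidueField

open IsLocalRing

variable {R : Type*} [CommRing R] {F G M : Type*} [AddCommGroup F] [Module R F]
  [AddCommGroup G] [Module R G] [AddCommGroup M] [Module R M]

lemma lcomp_bijective {π : F →ₗ[R] G} (hπ : Function.Surjective π)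
    (hker : ∀ f : F →ₗ[R] M, LinearMap.ker π ≤ LinearMap.ker f) :
    Function.Bijective (LinearMap.lcomp R M π) := by
  refine ⟨LinearMap.lcomp_injective_of_surjective π hπ, fun f ↦ ?_⟩
  refine (LinearMap.exact_lcomp_of_exact_of_surjective M
    (LinearMap.exact_subtype_ker_map π) hπ f).mp (LinearMap.ext fun z ↦ hker f z.2)

variable [IsLocalRing R]

lemma maximalIdeal_smul_top_le_ker (φ : M →ₗ[R] ResidueField R) :
    maximalIdeal R • ⊤ ≤ LinearMap.ker φ :=
  Submodule.smul_le.mpr fun r hr m _ ↦ by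
    rw [LinearMap.mem_ker, map_smul, Algebra.smul_def, ResidueField.algebraMap_eq,
      (residue_eq_zero_iff r).mpr hr, zero_mul]

lemma exists_residueField_functional_eq_one [Module.Finite R G] [Nontrivial G] :
    ∃ (ψ : G →ₗ[R] ResidueField R) (g : G), ψ g = 1 := by
  obtain ⟨n, π, hπ, hker⟩ := exists_minimal_free_cover R G
  obtain ⟨i⟩ : Nonempty (Fin n) := by
    by_contra! h
    exact not_subsingleton G hπ.subsingleton
  obtain ⟨ψ, hψ⟩ := (lcomp_bijective hπ fun f ↦
    hker.trans (maximalIdeal_smul_top_le_ker f)).2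
    (Algebra.linearMap R (ResidueField R) ∘ₗ LinearMap.proj i)
  exact ⟨ψ, π (Pi.single i 1), congr($hψ (Pi.single i 1)).trans (by simp)⟩

lemma nonempty_retract_residueField_linearMap {R : Type u} [CommRing R] [IsLocalRing R]
    (G : Type u) [AddCommGroup G] [Module R G] [Module.Finite R G] [Nontrivial G] :
    Nonempty (Retract (ModuleCat.of R (ResidueField R))
      (ModuleCat.of R (G →ₗ[R] ResidueField R))) := by
  obtain ⟨ψ, g, hψ⟩ := exists_residueField_functional_eq_one (R := R) (G := G)
  exact ⟨{
    i := ModuleCat.ofHom (LinearMap.lcomp R (ResidueField R) ψ ∘ₗ LinearMap.mul R (ResidueField R))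
    r := ModuleCat.ofHom (LinearMap.applyₗ g)
    retract := by ext a; exact (congrArg (a * ·) hψ).trans (mul_one a) }⟩

end ResidueField

/-- A subcategory of finitely generated modules is resolving if it contains the finitely generated
projective modules and is closed under direct summands, extensions and kernels of epimorphisms. -/
class IsResolving {R : Type u} [CommRing R] (𝒳 : ObjectProperty (ModuleCat.{u} R)) : Prop extends
    𝒳.IsStableUnderRetracts, 𝒳.IsClosedUnderExtensions where
  finite (M : ModuleCat.{u} R) : 𝒳 M → Module.Finite R M
  prop_of_projective (M : ModuleCat.{u} R) : Module.Finite R M → Module.Projective R M → 𝒳 M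
  prop_X₁_of_shortExact {S : ShortComplex (ModuleCat.{u} R)} : S.ShortExact → 𝒳 S.X₂ → 𝒳 S.X₃ →
    𝒳 S.X₁

section HomSequences

variable {R : Type u} [CommRing R] {F G X L : Type u} [AddCommGroup F] [Module R F]
  [AddCommGroup G] [Module R G] [AddCommGroup X] [Module R X] [AddCommGroup L] [Module R L]
  (φ : X →ₗ[R] L) {π : F →ₗ[R] G}

variable (G) in
/-- The sequence `0 → Hom(G, ker φ) → Hom(G, X) → Hom(G, L)` obtained from `φ : X → L`. -/
abbrev homShortComplex : ShortComplex (ModuleCat.{u} R) :=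
  ModuleCat.shortComplexOfCompEqZero (M := G →ₗ[R] LinearMap.ker φ) (N := G →ₗ[R] X)
    (L := G →ₗ[R] L) (LinearMap.compRight R (LinearMap.ker φ).subtype) (LinearMap.compRight R φ)
    (by ext h x; exact (h x).2)

lemma shortExact_homShortComplex
    (hlift : ∀ f : G →ₗ[R] L, ∃ g : G →ₗ[R] X, φ ∘ₗ g = f) :
    (homShortComplex G φ).ShortExact := by
  refine ModuleCat.shortComplex_shortExact _ (fun f ↦ ⟨fun hf ↦ ?_, ?_⟩) (fun f g h ↦ ?_) hlift
  · exact ⟨f.codRestrict (LinearMap.ker φ) fun x ↦ congr($hf x), rfl⟩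
  · rintro ⟨g, rfl⟩
    ext x
    exact (g x).2
  · ext x
    exact congr($h x)

variable (π) in
/-- Precomposition with `π : F → G`, as a morphism of short complexes. -/
abbrev homShortComplexMap : homShortComplex G φ ⟶ homShortComplex F φ where
  τ₁ := ModuleCat.ofHom (LinearMap.lcomp R (LinearMap.ker φ) π)
  τ₂ := ModuleCat.ofHom (LinearMap.lcomp R X π)
  τ₃ := ModuleCat.ofHom (LinearMap.lcomp R L π)

variable {φ}

/-- Restriction `Hom(F, X) → Hom(ker π, ker φ)`, when all homomorphisms `F → L` vanish on
`ker π`. -/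
def restrictKer (hker : ∀ f : F →ₗ[R] L, LinearMap.ker π ≤ LinearMap.ker f) :
    (F →ₗ[R] X) →ₗ[R] (LinearMap.ker π →ₗ[R] LinearMap.ker φ) where
  toFun f := f.restrict (hker (φ ∘ₗ f))
  map_add' _ _ := rfl
  map_smul' _ _ := rfl

lemma exact_lcomp_restrictKer (hπ : Function.Surjective π)
    (hker : ∀ f : F →ₗ[R] L, LinearMap.ker π ≤ LinearMap.ker f) :
    Function.Exact (LinearMap.lcomp R X π) (restrictKer (φ := φ) hker) := fun f ↦ by
  rw [← LinearMap.exact_lcomp_of_exact_of_surjective X (LinearMap.exact_subtype_ker_map π) hπ f]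
  exact ⟨fun h ↦ LinearMap.ext fun z ↦ congr((($h z : LinearMap.ker φ) : X)),
    fun h ↦ LinearMap.ext fun z ↦ Subtype.ext congr($h z)⟩

lemma shortExact_lcomp_restrictKer (hπ : Function.Surjective π)
    (hker : ∀ f : F →ₗ[R] L, LinearMap.ker π ≤ LinearMap.ker f)
    (hext : ∀ f : LinearMap.ker π →ₗ[R] LinearMap.ker φ,
      ∃ g : F →ₗ[R] LinearMap.ker φ, g ∘ₗ (LinearMap.ker π).subtype = f) :
    (ModuleCat.shortComplexOfCompEqZero (LinearMap.lcomp R X π) (restrictKer (φ := φ) hker)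
      (exact_lcomp_restrictKer hπ hker).linearMap_comp_eq_zero).ShortExact := by
  refine ModuleCat.shortComplex_shortExact _ (exact_lcomp_restrictKer hπ hker)
    (LinearMap.lcomp_injective_of_surjective π hπ) fun f ↦ ?_
  obtain ⟨g, rfl⟩ := hext f
  exact ⟨(LinearMap.ker φ).subtype ∘ₗ g, rfl⟩

lemma nonempty_ext_hom_ker_linearEquiv (hπ : Function.Surjective π)
    (hker : ∀ f : F →ₗ[R] L, LinearMap.ker π ≤ LinearMap.ker f)
    (hlift : ∀ f : G →ₗ[R] L, ∃ g : G →ₗ[R] X, φ ∘ₗ g = f)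
    (hliftF : ∀ f : F →ₗ[R] L, ∃ g : F →ₗ[R] X, φ ∘ₗ g = f)
    (hext : ∀ f : LinearMap.ker π →ₗ[R] LinearMap.ker φ,
      ∃ g : F →ₗ[R] LinearMap.ker φ, g ∘ₗ (LinearMap.ker π).subtype = f)
    (N : ModuleCat.{u} R) {m : ℕ}
    (hN : ∀ i ≥ m, Subsingleton (Ext (ModuleCat.of R (F →ₗ[R] X)) N i)) :
    Nonempty (Ext (ModuleCat.of R (G →ₗ[R] LinearMap.ker φ)) N (m + 1) ≃ₗ[R]
      Ext (ModuleCat.of R (LinearMap.ker π →ₗ[R] LinearMap.ker φ)) N (m + 2) ×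
      Ext (ModuleCat.of R (G →ₗ[R] L)) N (m + 2)) := by
  have isIso_τ₃ : IsIso (homShortComplexMap φ π).τ₃ :=
    (ConcreteCategory.isIso_iff_bijective _).mpr (lcomp_bijective hπ hker)
  have hG := shortExact_homShortComplex φ hlift
  have hsec (i : ℕ) (hi : m ≤ i) : ∃ σ, extConnecting hG N R i ∘ₗ σ = .id :=
    have := hN i hi
    have := hN (i + 1) (by lia)
    exists_section_extConnecting hG N R (shortExact_homShortComplex φ hliftF)
      (homShortComplexMap φ π)
  have hsurj : Function.Surjective (extConnecting hG N R m) := fun x ↦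
    have ⟨σ, hσ⟩ := hsec m le_rfl
    ⟨σ x, congr($hσ x)⟩
  obtain ⟨e⟩ := nonempty_ext_linearEquiv_prod hG N R hsurj (hsec (m + 1) (by lia))
  have := hN (m + 1) (by lia)
  have := hN (m + 2) (by lia)
  let δ := LinearEquiv.ofBijective _ (extConnecting_bijective
    (shortExact_lcomp_restrictKer (φ := φ) hπ hker hext) N R (n := m + 1))
  exact ⟨e.trans (δ.prodCongr (.refl R _))⟩

end HomSequences

section Recursion

open IsLocalRing

variable {R : Type u} [CommRing R] {𝒳 : ObjectProperty (ModuleCat.{u} R)}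

lemma IsResolving.prop_pi [IsResolving 𝒳] (n : ℕ) : 𝒳 (ModuleCat.of R (Fin n → R)) :=
  IsResolving.prop_of_projective _ (inferInstanceAs (Module.Finite R (Fin n → R)))
    (inferInstanceAs (Module.Projective R (Fin n → R)))

lemma nontrivial_of_projectiveDimension_eq_top {G : ModuleCat.{u} R}
    (hG : projectiveDimension G = ⊤) : Nontrivial G := by
  by_contra! h
  have := (projectiveDimension_eq_bot_iff G).mpr ((ModuleCat.isZero_iff_subsingleton).mpr h)
  simp [hG] at this

lemma projectiveDimension_ker_eq_top {P G : Type u} [AddCommGroup P] [Module R P]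
    [Module.Projective R P] [AddCommGroup G] [Module R G] {π : P →ₗ[R] G}
    (hπ : Function.Surjective π) (hG : projectiveDimension (ModuleCat.of R G) = ⊤) :
    projectiveDimension (ModuleCat.of R (LinearMap.ker π)) = ⊤ := by
  contrapose! hG
  obtain ⟨d, hd⟩ := (projectiveDimension_ne_top_iff _).mp hG
  exact (projectiveDimension_ne_top_iff _).mpr ⟨d + 1,
    ((LinearMap.shortExact_shortComplexKer hπ).hasProjectiveDimensionLT_X₃_iff d
      (inferInstanceAs (Projective (ModuleCat.of R P)))).mpr hd⟩

lemma IsRightApproximation.exists_syzygy_ext_linearEquiv [IsLocalRing R] [IsResolving 𝒳]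
    {X : ModuleCat.{u} R} {φ : X ⟶ ModuleCat.of R (ResidueField R)}
    (hφ : IsRightApproximation 𝒳 φ) (hmin : IsRightMinimal φ) {N : ModuleCat.{u} R} {t : ℕ}
    (hN : ∀ i ≥ t, Subsingleton (Ext X N i)) {G : ModuleCat.{u} R} (hG : 𝒳 G)
    (hpd : projectiveDimension G = ⊤) :
    ∃ Z : ModuleCat.{u} R, 𝒳 Z ∧ projectiveDimension Z = ⊤ ∧ ∀ m ≥ t,
      Nonempty (Ext (ModuleCat.of R (G →ₗ[R] LinearMap.ker φ.hom)) N (m + 1) ≃ₗ[R]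
        Ext (ModuleCat.of R (Z →ₗ[R] LinearMap.ker φ.hom)) N (m + 2) ×
        Ext (ModuleCat.of R (G →ₗ[R] ResidueField R)) N (m + 2)) := by
  have := IsResolving.finite G hG
  obtain ⟨n, π, hπ, hker⟩ := exists_minimal_free_cover R G
  have hS := LinearMap.shortExact_shortComplexKer hπ
  have lift (M : ModuleCat.{u} R) (hM : 𝒳 M) (f : M →ₗ[R] ResidueField R) :
      ∃ g : M →ₗ[R] X, φ.hom ∘ₗ g = f :=
    have ⟨g, hg⟩ := hφ.2 M hM (ModuleCat.ofHom f)
    ⟨g.hom, congr(($hg).hom)⟩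
  refine ⟨ModuleCat.of R (LinearMap.ker π),
    IsResolving.prop_X₁_of_shortExact hS (IsResolving.prop_pi n) hG,
    projectiveDimension_ker_eq_top hπ hpd, fun m hm ↦ ?_⟩
  refine nonempty_ext_hom_ker_linearEquiv hπ
    (fun f ↦ hker.trans (maximalIdeal_smul_top_le_ker f)) (lift G hG)
    (lift _ (IsResolving.prop_pi n)) (fun f ↦ ?_) N fun i hi ↦ ?_
  · obtain ⟨g, hg, hgf⟩ := hφ.exists_extension hmin hS hG
      (ModuleCat.ofHom ((LinearMap.ker φ.hom).subtype ∘ₗ f)) (by ext z; exact (f z).2)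
    exact ⟨g.hom.codRestrict _ fun x ↦ congr(($hg).hom x),
      LinearMap.ext fun z ↦ Subtype.ext congr(($hgf).hom z)⟩
  · have := hN i (hm.trans hi)
    have := subsingleton_ext_pi (fun _ : Fin n ↦ X) N i
    exact subsingleton_ext_of_retract (LinearEquiv.piRing R X (Fin n) R).toModuleIso.retract N i

lemma IsRightApproximation.exists_syzygies_ext_linearEquiv [IsLocalRing R] [IsResolving 𝒳]
    {X : ModuleCat.{u} R} {φ : X ⟶ ModuleCat.of R (ResidueField R)}
    (hφ : IsRightApproximation 𝒳 φ) (hmin : IsRightMinimal φ) {N : ModuleCat.{u} R} {t : ℕ}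
    (hN : ∀ i ≥ t, Subsingleton (Ext X N i)) {G : ModuleCat.{u} R} (hG : 𝒳 G)
    (hpd : projectiveDimension G = ⊤) :
    ∃ Z : ℕ → ModuleCat.{u} R, ∀ n, 𝒳 (Z n) ∧ Nontrivial (Z n) ∧
      Nonempty (Ext (ModuleCat.of R (Z n →ₗ[R] LinearMap.ker φ.hom)) N (t + n + 1) ≃ₗ[R]
        Ext (ModuleCat.of R (Z (n + 1) →ₗ[R] LinearMap.ker φ.hom)) N (t + n + 2) ×
        Ext (ModuleCat.of R (Z n →ₗ[R] ResidueField R)) N (t + n + 2)) := by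
  choose! syzygy h𝒳 hpd' ext_equiv using fun (G : ModuleCat.{u} R)
    (hG : 𝒳 G ∧ projectiveDimension G = ⊤) ↦
      hφ.exists_syzygy_ext_linearEquiv hmin hN hG.1 hG.2
  have hZ (n : ℕ) : 𝒳 (syzygy^[n] G) ∧ projectiveDimension (syzygy^[n] G) = ⊤ := by
    induction n with
    | zero => exact ⟨hG, hpd⟩
    | succ n ih =>
      rw [Function.iterate_succ_apply']
      exact ⟨h𝒳 _ ih, hpd' _ ih⟩
  refine ⟨fun n ↦ syzygy^[n] G, fun n ↦
    ⟨(hZ n).1, nontrivial_of_projectiveDimension_eq_top (hZ n).2, ?_⟩⟩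
  beta_reduce
  rw [Function.iterate_succ_apply']
  exact ext_equiv _ (hZ n) (t + n) (Nat.le_add_right t n)

lemma exists_forall_ge_eq_zero {b c : ℕ → ℕ} (h : ∀ n, c n = c (n + 1) + b n) :
    ∃ n₀, ∀ n ≥ n₀, b n = 0 := by
  have hc : Antitone c := antitone_nat_of_succ_le fun n ↦ by rw [h n]; exact Nat.le_add_right ..
  obtain ⟨n₀, hn₀⟩ := WellFoundedGT.monotone_chain_condition (α := ℕᵒᵈ)
    ⟨OrderDual.toDual ∘ c, hc.dual_right⟩
  refine ⟨n₀, fun n hn ↦ ?_⟩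
  have h₁ : c n₀ = c n := hn₀ n hn
  have h₂ : c n₀ = c (n + 1) := hn₀ (n + 1) (by lia)
  have := h n
  lia

lemma IsRightApproximation.exists_forall_subsingleton_ext_residueField [IsLocalRing R]
    [IsNoetherianRing R] [IsResolving 𝒳]
    {X : ModuleCat.{u} R} {φ : X ⟶ ModuleCat.of R (ResidueField R)}
    (hφ : IsRightApproximation 𝒳 φ) (hmin : IsRightMinimal φ) {N : ModuleCat.{u} R}
    [Module.Finite R N] {t : ℕ} (hN : ∀ i ≥ t, Subsingleton (Ext X N i)) {G : ModuleCat.{u} R}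
    (hG : 𝒳 G) (hpd : projectiveDimension G = ⊤) :
    ∃ n, ∀ i ≥ n, Subsingleton (Ext (ModuleCat.of R (ResidueField R)) N i) := by
  obtain ⟨Z, hZ⟩ := hφ.exists_syzygies_ext_linearEquiv hmin hN hG hpd
  have finite_Z (n : ℕ) : Module.Finite R (Z n) := IsResolving.finite _ (hZ n).1
  have finite_X : Module.Finite R X := IsResolving.finite _ hφ.1
  let c (n : ℕ) := (⊤ : Submodule R
    (Ext (ModuleCat.of R (Z n →ₗ[R] LinearMap.ker φ.hom)) N (t + n + 1))).spanFinrank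
  let b (n : ℕ) := (⊤ : Submodule R
    (Ext (ModuleCat.of R (Z n →ₗ[R] ResidueField R)) N (t + n + 2))).spanFinrank
  have hc (n : ℕ) : c n = c (n + 1) + b n :=
    have ⟨_, _, ⟨e⟩⟩ := hZ n
    (spanFinrank_top_congr e).trans spanFinrank_top_prod
  obtain ⟨n₀, hn₀⟩ := exists_forall_ge_eq_zero hc
  refine ⟨t + n₀ + 2, fun i hi ↦ ?_⟩
  obtain ⟨n, rfl, hn⟩ : ∃ n, i = t + n + 2 ∧ n₀ ≤ n := ⟨i - (t + 2), by lia⟩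
  have := spanFinrank_top_eq_zero_iff.mp (hn₀ n hn)
  have := (hZ n).2.1
  obtain ⟨r⟩ := nonempty_retract_residueField_linearMap (R := R) (Z n)
  exact subsingleton_ext_of_retract r N _

theorem injectiveDimension_ne_top_of_hasRightApproximation [HenselianLocalRing R]
    [IsNoetherianRing R] [IsResolving 𝒳] (N : ModuleCat.{u} R) [Module.Finite R N]
    (hN : ∀ X, 𝒳 X → ∃ t, ∀ i ≥ t, Subsingleton (Ext X N i)) {G : ModuleCat.{u} R} (hG : 𝒳 G)
    (hpd : projectiveDimension G = ⊤)
    (hk : HasRightApproximation 𝒳 (ModuleCat.of R (ResidueField R))) :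
    injectiveDimension N ≠ ⊤ := by
  obtain ⟨X, φ, hφ, hmin⟩ := exists_isRightMinimal_approximation IsResolving.finite hk
  obtain ⟨t, ht⟩ := hN X hφ.1
  obtain ⟨n, hn⟩ := hφ.exists_forall_subsingleton_ext_residueField hmin ht hG hpd
  exact injectiveDimension_ne_top_of_subsingleton_ext_residueField N n hn

end Recursion

section ExtVanishing

variable {R : Type u} [CommRing R]

lemma subsingleton_ext_of_projective (M N : ModuleCat.{u} R) [Module.Projective R M] {i : ℕ}
    (hi : 0 < i) : Subsingleton (Ext M N i) := by
  obtain ⟨i, rfl⟩ := Nat.exists_eq_add_one.mpr hi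
  exact subsingleton_of_forall_eq 0 Ext.eq_zero_of_projective

lemma finite_X₁ [IsNoetherianRing R] {S : ShortComplex (ModuleCat.{u} R)} (hS : S.ShortExact)
    [Module.Finite R S.X₂] : Module.Finite R S.X₁ :=
  Module.Finite.of_injective S.f.hom hS.moduleCat_injective_f

lemma finite_X₂ {S : ShortComplex (ModuleCat.{u} R)} (hS : S.ShortExact)
    [Module.Finite R S.X₁] [Module.Finite R S.X₃] : Module.Finite R S.X₂ :=
  Module.Finite.of_exact
    ((ShortComplex.ShortExact.moduleCat_exact_iff_function_exact S).mp hS.exact)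
    hS.moduleCat_surjective_g

lemma finite_of_retract {M N : ModuleCat.{u} R} (r : Retract M N) [Module.Finite R N] :
    Module.Finite R M :=
  Module.Finite.of_surjective r.r.hom fun x ↦ ⟨r.i x, congr($(r.retract).hom x)⟩

instance extVanishingAbove.isStableUnderRetracts (n : ℕ) :
    (extVanishingAbove R n).IsStableUnderRetracts where
  of_retract r h :=
    have := h.1
    ⟨finite_of_retract r, fun i hi ↦
      have : Subsingleton (Ext _ _ i) := h.2 i hi
      subsingleton_ext_of_retract r _ i⟩

instance extVanishingAbove.isClosedUnderExtensions (n : ℕ) :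
    (extVanishingAbove R n).IsClosedUnderExtensions where
  prop_X₂_of_shortExact {S} hS h₁ h₃ :=
    have := h₁.1
    have := h₃.1
    ⟨finite_X₂ hS, fun i hi ↦
      have : Subsingleton (Ext S.X₁ _ i) := h₁.2 i hi
      have : Subsingleton (Ext S.X₃ _ i) := h₃.2 i hi
      subsingleton_ext_X₂ hS _⟩

instance extVanishingAbove.isResolving [IsNoetherianRing R] (n : ℕ) :
    IsResolving (extVanishingAbove R n) where
  finite _ h := h.1
  prop_of_projective M _ _ := ⟨‹_›, fun _ hi ↦ subsingleton_ext_of_projective M _ (by lia)⟩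
  prop_X₁_of_shortExact {S} hS h₂ h₃ :=
    have := h₂.1
    ⟨finite_X₁ hS, fun i hi ↦
      have : Subsingleton (Ext S.X₂ _ i) := h₂.2 i hi
      have : Subsingleton (Ext S.X₃ _ (i + 1)) := h₃.2 (i + 1) (by lia)
      subsingleton_ext_X₁ hS _⟩

lemma extVanishingAbove_mono : Monotone (extVanishingAbove R) :=
  fun _ _ hmn _ h ↦ ⟨h.1, fun i hi ↦ h.2 i (hmn.trans_lt hi)⟩

lemma extVanishingEventually_iff (M : ModuleCat.{u} R) :
    extVanishingEventually R M ↔ ∃ n, extVanishingAbove R n M :=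
  exists_and_left.symm

lemma extVanishingAbove_le_extVanishingEventually (n : ℕ) :
    extVanishingAbove R n ≤ extVanishingEventually R :=
  fun M h ↦ (extVanishingEventually_iff M).mpr ⟨n, h⟩

lemma extVanishingEventually_and_iff {M N : ModuleCat.{u} R} :
    extVanishingEventually R M ∧ extVanishingEventually R N ↔
      ∃ n, extVanishingAbove R n M ∧ extVanishingAbove R n N := by
  simp only [extVanishingEventually_iff]
  exact ⟨fun ⟨⟨m, hm⟩, n, hn⟩ ↦ ⟨max m n, extVanishingAbove_mono (le_max_left m n) _ hm,
    extVanishingAbove_mono (le_max_right m n) _ hn⟩, fun ⟨n, hM, hN⟩ ↦ ⟨⟨n, hM⟩, n, hN⟩⟩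

instance extVanishingEventually.isResolving [IsNoetherianRing R] :
    IsResolving (extVanishingEventually R) where
  of_retract r h :=
    have ⟨n, hn⟩ := (extVanishingEventually_iff _).mp h
    (extVanishingEventually_iff _).mpr ⟨n, ObjectProperty.prop_of_retract _ r hn⟩
  prop_X₂_of_shortExact hS h₁ h₃ :=
    have ⟨n, hn₁, hn₃⟩ := extVanishingEventually_and_iff.mp ⟨h₁, h₃⟩
    (extVanishingEventually_iff _).mpr ⟨n, ObjectProperty.prop_X₂_of_shortExact _ hS hn₁ hn₃⟩
  finite _ h := h.1
  prop_of_projective M hM hM' :=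
    (extVanishingEventually_iff M).mpr ⟨0, IsResolving.prop_of_projective M hM hM'⟩
  prop_X₁_of_shortExact hS h₂ h₃ :=
    have ⟨n, hn₂, hn₃⟩ := extVanishingEventually_and_iff.mp ⟨h₂, h₃⟩
    (extVanishingEventually_iff _).mpr ⟨n, IsResolving.prop_X₁_of_shortExact hS hn₂ hn₃⟩

end ExtVanishing

section TotallyReflexive

lemma isIso_τ₁_of_isIso₂₃ {C : Type*} [Category* C] [Preadditive C] [Balanced C]
    {S T : ShortComplex C} (hS : S.ShortExact) (hT : T.ShortExact) (φ : S ⟶ T) [IsIso φ.τ₂]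
    [IsIso φ.τ₃] : IsIso φ.τ₁ := by
  have := hS.mono_f
  have := hT.mono_f
  have hlift : (T.f ≫ inv φ.τ₂) ≫ S.g = 0 := by
    rw [← cancel_mono φ.τ₃, Category.assoc, ← φ.comm₂₃, Category.assoc, IsIso.inv_hom_id_assoc,
      T.zero, Limits.zero_comp]
  have hf : hS.exact.lift (T.f ≫ inv φ.τ₂) hlift ≫ S.f = T.f ≫ inv φ.τ₂ := hS.exact.lift_f _ hlift
  refine ⟨hS.exact.lift (T.f ≫ inv φ.τ₂) hlift, ?_, ?_⟩
  · rw [← cancel_mono S.f, Category.assoc, hf, φ.comm₁₂_assoc, IsIso.hom_inv_id, Category.comp_id,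
      Category.id_comp]
  · rw [← cancel_mono T.f, Category.assoc, φ.comm₁₂, reassoc_of% hf, IsIso.inv_hom_id,
      Category.comp_id, Category.id_comp]

variable {R : Type u} [CommRing R]

variable (R) in
/-- The duality functor `M ↦ M* = Hom_R(M, R)`. -/
abbrev dual : (ModuleCat.{u} R)ᵒᵖ ⥤ ModuleCat.{u} R where
  obj M := ModuleCat.of R (Module.Dual R M.unop)
  map f := ModuleCat.ofHom f.unop.hom.dualMap

instance : (dual R).Additive where
  map_add {_ _ f g} := by ext; simp

variable (R) in
/-- The biduality functor `M ↦ M**`. -/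
abbrev bidual : ModuleCat.{u} R ⥤ ModuleCat.{u} R := (dual R).rightOp ⋙ dual R

variable (R) in
/-- The natural map `M → M**`. -/
abbrev evaluation : 𝟭 (ModuleCat.{u} R) ⟶ bidual R where
  app M := ModuleCat.ofHom (Module.Dual.eval R M)

lemma totallyReflexive_iff (M : ModuleCat.{u} R) : totallyReflexive R M ↔
    extVanishingAbove R 0 M ∧ IsIso ((evaluation R).app M) ∧
      ∀ i, 0 < i → ExtToRingVanishes R ((dual R).obj (.op M)) i := by
  rw [ConcreteCategory.isIso_iff_bijective]
  exact ⟨fun h ↦ ⟨⟨h.1, fun i hi ↦ (h.2.2 i hi).1⟩, h.2.1, fun i hi ↦ (h.2.2 i hi).2⟩,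
    fun h ↦ ⟨h.1.1, h.2.1, fun i hi ↦ ⟨h.1.2 i hi, h.2.2 i hi⟩⟩⟩

lemma totallyReflexive_le_extVanishingAbove : totallyReflexive R ≤ extVanishingAbove R 0 :=
  fun M h ↦ ((totallyReflexive_iff M).mp h).1

lemma totallyReflexive_le_extVanishingEventually :
    totallyReflexive R ≤ extVanishingEventually R :=
  totallyReflexive_le_extVanishingAbove.trans (extVanishingAbove_le_extVanishingEventually 0)

lemma shortExact_map_dual {S : ShortComplex (ModuleCat.{u} R)} (hS : S.ShortExact)
    (h : ∀ f : S.X₁ ⟶ ModuleCat.of R R, ∃ g : S.X₂ ⟶ ModuleCat.of R R, S.f ≫ g = f) :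
    (S.op.map (dual R)).ShortExact := by
  have hexact := (ShortComplex.ShortExact.moduleCat_exact_iff_function_exact S).mp hS.exact
  refine ModuleCat.shortComplex_shortExact _
    (LinearMap.exact_lcomp_of_exact_of_surjective R hexact hS.moduleCat_surjective_g)
    (LinearMap.lcomp_injective_of_surjective _ hS.moduleCat_surjective_g) fun f ↦ ?_
  obtain ⟨g, hg⟩ := h (ModuleCat.ofHom f)
  exact ⟨g.hom, congr($(hg).hom)⟩

lemma exists_extension_dual {S : ShortComplex (ModuleCat.{u} R)} (hS : S.ShortExact)
    [IsIso ((evaluation R).app S.X₃)] (f : (dual R).obj (.op S.X₃) ⟶ ModuleCat.of R R) :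
    ∃ g : (dual R).obj (.op S.X₂) ⟶ ModuleCat.of R R, (dual R).map S.g.op ≫ g = f := by
  obtain ⟨y, hy⟩ := (ConcreteCategory.bijective_of_isIso ((evaluation R).app S.X₃)).2 f.hom
  obtain ⟨x, rfl⟩ := hS.moduleCat_surjective_g y
  exact ⟨ModuleCat.ofHom (Module.Dual.eval R S.X₂ x), ModuleCat.hom_ext hy⟩

namespace totallyReflexive

lemma prop_X₂ {S : ShortComplex (ModuleCat.{u} R)} (hS : S.ShortExact)
    (h₁ : totallyReflexive R S.X₁) (h₃ : totallyReflexive R S.X₃) : totallyReflexive R S.X₂ := by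
  rw [totallyReflexive_iff] at h₁ h₃ ⊢
  obtain ⟨hX₁, iso₁, hdual₁⟩ := h₁
  obtain ⟨hX₃, iso₃, hdual₃⟩ := h₃
  have : Subsingleton (Ext S.X₃ (ModuleCat.of R R) 1) := hX₃.2 1 one_pos
  have hS' : (S.op.map (dual R)).ShortExact :=
    shortExact_map_dual hS (exists_extension_of_subsingleton_ext hS)
  have : Subsingleton (Ext (S.op.map (dual R)).X₃ (ModuleCat.of R R) 1) := hdual₁ 1 one_pos
  have hS'' : (S.map (bidual R)).ShortExact :=
    shortExact_map_dual hS' (exists_extension_of_subsingleton_ext hS')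
  let φ : S ⟶ S.map (bidual R) := S.mapNatTrans (evaluation R)
  have : IsIso φ.τ₁ := iso₁
  have : IsIso φ.τ₃ := iso₃
  refine ⟨ObjectProperty.prop_X₂_of_shortExact _ hS hX₁ hX₃,
    ShortComplex.isIso₂_of_shortExact_of_isIso₁₃ φ hS hS'', fun i hi ↦ ?_⟩
  have : Subsingleton (Ext (S.op.map (dual R)).X₁ (ModuleCat.of R R) i) := hdual₃ i hi
  have : Subsingleton (Ext (S.op.map (dual R)).X₃ (ModuleCat.of R R) i) := hdual₁ i hi
  exact subsingleton_ext_X₂ hS' _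

lemma prop_X₁ [IsNoetherianRing R] {S : ShortComplex (ModuleCat.{u} R)} (hS : S.ShortExact)
    (h₂ : totallyReflexive R S.X₂) (h₃ : totallyReflexive R S.X₃) : totallyReflexive R S.X₁ := by
  rw [totallyReflexive_iff] at h₂ h₃ ⊢
  obtain ⟨hX₂, iso₂, hdual₂⟩ := h₂
  obtain ⟨hX₃, iso₃, hdual₃⟩ := h₃
  have : Subsingleton (Ext S.X₃ (ModuleCat.of R R) 1) := hX₃.2 1 one_pos
  have hS' : (S.op.map (dual R)).ShortExact :=
    shortExact_map_dual hS (exists_extension_of_subsingleton_ext hS)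
  have hS'' : (S.map (bidual R)).ShortExact := shortExact_map_dual hS' (exists_extension_dual hS)
  let φ : S ⟶ S.map (bidual R) := S.mapNatTrans (evaluation R)
  have : IsIso φ.τ₂ := iso₂
  have : IsIso φ.τ₃ := iso₃
  refine ⟨IsResolving.prop_X₁_of_shortExact hS hX₂ hX₃,
    isIso_τ₁_of_isIso₂₃ hS hS'' φ, fun i hi ↦ ?_⟩
  have : Subsingleton (Ext (S.op.map (dual R)).X₂ (ModuleCat.of R R) i) := hdual₂ i hi
  obtain _ | _ | i := i
  · exact absurd hi (lt_irrefl 0)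
  · exact subsingleton_ext_one_X₃ hS' (exists_extension_dual hS)
  · have : Subsingleton (Ext (S.op.map (dual R)).X₁ (ModuleCat.of R R) (i + 1)) :=
      hdual₃ (i + 1) i.succ_pos
    exact subsingleton_ext_X₃ hS' _

lemma prop_of_retract {M N : ModuleCat.{u} R} (r : Retract M N)
    (h : totallyReflexive R N) : totallyReflexive R M := by
  rw [totallyReflexive_iff] at h ⊢
  obtain ⟨hN, iso, hdual⟩ := h
  refine ⟨ObjectProperty.prop_of_retract _ r hN, MorphismProperty.of_retract
    (P := .isomorphisms _) (NatTrans.retractArrowApp (evaluation R) r) iso, fun i hi ↦ ?_⟩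
  have : Subsingleton (Ext ((dual R).obj (.op N)) (ModuleCat.of R R) i) := hdual i hi
  exact subsingleton_ext_of_retract (r.op.map (dual R)) _ i

instance isResolving [IsNoetherianRing R] : IsResolving (totallyReflexive R) where
  of_retract := prop_of_retract
  prop_X₂_of_shortExact := prop_X₂
  finite _ h := h.1
  prop_of_projective M _ _ := ⟨‹_›, Module.bijective_dual_eval R M, fun _ hi ↦
    ⟨subsingleton_ext_of_projective M _ hi,
      subsingleton_ext_of_projective (ModuleCat.of R (Module.Dual R M)) _ hi⟩⟩
  prop_X₁_of_shortExact := prop_X₁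

end totallyReflexive

end TotallyReflexive

section Free

variable {R : Type u} [CommRing R]

lemma subsingleton_ext_target_of_projective {M : ModuleCat.{u} R} {i : ℕ}
    [Subsingleton (Ext M (ModuleCat.of R R) i)] (P : Type u) [AddCommGroup P] [Module R P]
    [Module.Finite R P] [Module.Projective R P] :
    Subsingleton (Ext M (ModuleCat.of R P) i) := by
  obtain ⟨n, π, ι, -, -, hπι⟩ := Module.Finite.exists_comp_eq_id_of_projective R P
  have := subsingleton_ext_target_pi (fun _ : Fin n ↦ ModuleCat.of R R) M i
  let r : Retract (ModuleCat.of R P) (ModuleCat.of R (Fin n → R)) :=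
    { i := ModuleCat.ofHom ι, r := ModuleCat.ofHom π, retract := ModuleCat.hom_ext hπι }
  exact subsingleton_ext_of_retract_target r M i

lemma projective_of_hasProjectiveDimensionLE [IsNoetherianRing R] (n : ℕ) (M : ModuleCat.{u} R)
    (hM : extVanishingAbove R 0 M) (hn : HasProjectiveDimensionLE M n) : Projective M := by
  induction n generalizing M with
  | zero => exact projective_iff_hasProjectiveDimensionLT_one.mpr hn
  | succ n ih =>
    have := hM.1
    obtain ⟨r, π, hπ⟩ := Module.Finite.exists_fin' R M
    have hS := LinearMap.shortExact_shortComplexKer hπ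
    have hK : Projective (ModuleCat.of R (LinearMap.ker π)) :=
      ih _ (IsResolving.prop_X₁_of_shortExact hS (IsResolving.prop_pi r) hM)
        ((hS.hasProjectiveDimensionLT_X₃_iff n inferInstance).mp hn)
    have := (IsProjective.iff_projective (R := R) (LinearMap.ker π)).mpr hK
    have : Subsingleton (Ext M (ModuleCat.of R R) 1) := hM.2 1 one_pos
    have := subsingleton_ext_target_of_projective (M := M) (i := 1) (LinearMap.ker π)
    obtain ⟨ρ, hρ⟩ := exists_extension_of_subsingleton_ext hS (𝟙 _)
    let s := ShortComplex.Splitting.ofExactOfRetraction _ hS.exact ρ hρ hS.epi_g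
    exact Retract.projective (Y := ModuleCat.of R (Fin r → R)) ⟨s.s, _, s.s_g⟩

lemma projectiveDimension_eq_top_of_not_free [IsNoetherianRing R] [IsLocalRing R]
    {M : ModuleCat.{u} R} (hM : extVanishingAbove R 0 M) (hfree : ¬ Module.Free R M) :
    projectiveDimension M = ⊤ := by
  contrapose! hfree
  obtain ⟨n, hn⟩ := (projectiveDimension_ne_top_iff M).mp hfree
  have := hM.1
  have := (IsProjective.iff_projective (R := R) M).mpr
    (projective_of_hasProjectiveDimensionLE n M hM hn)
  exact Module.free_of_flat_of_isLocalRing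

end Free

section Gorenstein

variable {R : Type u} [CommRing R] [HenselianLocalRing R] [IsNoetherianRing R]

theorem isGorenstein_of_hasRightApproximation {𝒳 : ObjectProperty (ModuleCat.{u} R)}
    [IsResolving 𝒳] (h𝒳 : 𝒳 ≤ extVanishingEventually R) {G : ModuleCat.{u} R} (hG : 𝒳 G)
    (hpd : projectiveDimension G = ⊤)
    (hk : HasRightApproximation 𝒳 (ModuleCat.of R (IsLocalRing.ResidueField R))) :
    IsGorenstein R := by
  refine injectiveDimension_ne_top_of_hasRightApproximation (ModuleCat.of R R) (fun X hX ↦ ?_)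
    hG hpd hk
  obtain ⟨-, n, hn⟩ := h𝒳 X hX
  exact ⟨n + 1, hn⟩

theorem isGorenstein_of_totallyReflexive_of_not_free {G : ModuleCat.{u} R}
    (hG : totallyReflexive R G) (hfree : ¬ Module.Free R G)
    (hk : HasRightApproximation (totallyReflexive R)
      (ModuleCat.of R (IsLocalRing.ResidueField R))) :
    IsGorenstein R :=
  isGorenstein_of_hasRightApproximation totallyReflexive_le_extVanishingEventually hG
    (projectiveDimension_eq_top_of_not_free (totallyReflexive_le_extVanishingAbove G hG) hfree) hk

end Gorenstein

end RightApprox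

theorem corollary1p5 (R : Type u) [CommRing R] [IsNoetherianRing R] [HenselianLocalRing R] :
    (∀ 𝒳 : ObjectProperty (ModuleCat.{u} R),
      (𝒳 = RightApprox.totallyReflexive R ∨
        (∃ n : ℕ, 𝒳 = RightApprox.extVanishingAbove R n) ∨
        𝒳 = RightApprox.extVanishingEventually R) →
      (∃ G : ModuleCat.{u} R, 𝒳 G ∧ projectiveDimension G = ⊤) →
      RightApprox.HasRightApproximation 𝒳 (ModuleCat.of R (IsLocalRing.ResidueField R)) →
      RightApprox.IsGorenstein R) ∧
    ((∃ G : ModuleCat.{u} R, RightApprox.totallyReflexive R G ∧ ¬ Module.Free R G) →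
      RightApprox.HasRightApproximation (RightApprox.totallyReflexive R)
        (ModuleCat.of R (IsLocalRing.ResidueField R)) →
      RightApprox.IsGorenstein R) ∧
    ((∃ G : ModuleCat.{u} R, RightApprox.totallyReflexive R G ∧ ¬ Module.Free R G) →
      RightApprox.IsContravariantlyFinite (RightApprox.totallyReflexive R) →
      RightApprox.IsGorenstein R) := by
  refine ⟨?_, ?_, ?_⟩
  · rintro 𝒳 (rfl | ⟨n, rfl⟩ | rfl) ⟨G, hG, hpd⟩ hk
    · exact RightApprox.isGorenstein_of_hasRightApproximation
        RightApprox.totallyReflexive_le_extVanishingEventually hG hpd hk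
    · exact RightApprox.isGorenstein_of_hasRightApproximation
        (RightApprox.extVanishingAbove_le_extVanishingEventually n) hG hpd hk
    · exact RightApprox.isGorenstein_of_hasRightApproximation le_rfl hG hpd hk
  · rintro ⟨G, hG, hfree⟩ hk
    exact RightApprox.isGorenstein_of_totallyReflexive_of_not_free hG hfree hk
  · rintro ⟨G, hG, hfree⟩ hfin
    have hk := hfin (ModuleCat.of R (IsLocalRing.ResidueField R))
      (inferInstanceAs (Module.Finite R (IsLocalRing.ResidueField R)))
    exact RightApprox.isGorenstein_of_totallyReflexive_of_not_free hG hfree hk
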